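/- Let $R$ be a commutative ring in which $2$ is invertible, let $I$ be an ideal of $R$, and let $n \ge 2$. For $m \ge 1$ let $\mathrm{Um}_m(R,I)$ be the set of rows $v \in R^m$ that are unimodular (i.e. $\sum_i v_i w_i = 1$ for some $w \in R^m$) and congruent to $e_1 = (1,0,\dots,0)$ modulo $I$. For an ideal $J$ of $R$ let $\mathrm{E}_m(J) \subseteq \mathrm{SL}_m(R)$ be the subgroup generated by the matrices $1 + x e_{ij}$ with $x \in J$, $i \ne j$; put $\mathrm{E}_m(R)$ for the case $J = R$, and let $\mathrm{E}_m(R,I)$ be the normal closure of $\mathrm{E}_m(I)$ in $\mathrm{E}_m(R)$. Let $\sigma$ be the permutation of $\{1,\dots,2n\}$ with $\sigma(2i) = 2i-1$ and $\sigma(2i-1) = 2i$, and for $i \ne j$ and $z \in R$ let $se_{ij}(z) = 1 + z e_{ij}$ if $i = \sigma(j)$ and $se_{ij}(z) = 1 + z e_{ij} - (-1)^{i+j} z e_{\sigma(j)\sigma(i)}$ if $i \ne \sigma(j)$. Let $\mathrm{ESp}_{2n}(J)$ be the group generated by the $se_{ij}(x)$ with $x \in J$, $i \ne j$; put $\mathrm{ESp}_{2n}(R)$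 for the case $J = R$, and let $\mathrm{ESp}_{2n}(R,I)$ be the normal closure of $\mathrm{ESp}_{2n}(I)$ in $\mathrm{ESp}_{2n}(R)$. The groups $\mathrm{ESp}_{2n}(R,I) \subseteq \mathrm{E}_{2n}(R,I)$ act on $\mathrm{Um}_{2n}(R,I)$ by right multiplication. Then the natural map of orbit sets, sending the orbit of a row to its orbit under the larger group, $$\mathrm{Um}_{2n}(R,I)/\mathrm{ESp}_{2n}(R,I) \longrightarrow \mathrm{Um}_{2n}(R,I)/\mathrm{E}_{2n}(R,I)$$ is bijective. -/

import Mathlib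

namespace ElemOrbits

open Matrix

/-- The first standard basis row `e₁ = (1, 0, …, 0)` of length `m`. -/
def firstRow (m : ℕ) (R : Type*) [CommRing R] : Fin m → R :=
  fun i => if i.val = 0 then 1 else 0

/-- `Um_m(R, I)`: the unimodular rows of length `m` over `R` that are congruent to
`e₁` modulo `I`. -/
def Um (m : ℕ) {R : Type*} [CommRing R] (I : Ideal R) : Set (Fin m → R) :=
  {v | (∃ w : Fin m → R, ∑ i, v i * w i = 1) ∧ ∀ i, v i - firstRow m R i ∈ I}

/-- `E_m(I)`: the subgroup of `SL_m(R)` generated by the `E_ij(x) = 1 + x e_ij` with `x ∈ I`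
and `i ≠ j`. -/
def EGen (m : ℕ) {R : Type*} [CommRing R] (I : Ideal R) :
    Subgroup (SpecialLinearGroup (Fin m) R) :=
  Subgroup.closure {g | ∃ (i j : Fin m) (hij : i ≠ j), ∃ x ∈ I,
    g = SpecialLinearGroup.transvection hij x}

/-- The elementary group `E_m(R)`. -/
def EAbs (m : ℕ) (R : Type*) [CommRing R] : Subgroup (SpecialLinearGroup (Fin m) R) :=
  EGen m (⊤ : Ideal R)

/-- For subgroups `H`, `K` of a group, the normal closure of `H ∩ K` in the group `K`, seen as a
subgroup of the ambient group. It is used for `H ≤ K` only. -/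
def normalClosureIn {G : Type*} [Group G] (H K : Subgroup G) : Subgroup G :=
  (Subgroup.normalClosure ((H.subgroupOf K : Subgroup K) : Set K)).map K.subtype

/-- The relative elementary group `E_m(R, I)`: the normal closure of `E_m(I)` in `E_m(R)`. -/
def ERel (m : ℕ) {R : Type*} [CommRing R] (I : Ideal R) :
    Subgroup (SpecialLinearGroup (Fin m) R) :=
  normalClosureIn (EGen m I) (EAbs m R)

/-- The involution of the index set exchanging the members of the consecutive pairs
`{1, 2}, {3, 4}, …, {2n - 1, 2n}`. As `Fin (2 * n)` counts from `0`, the pairs are here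
`{0, 1}, {2, 3}, …`. -/
def sig {n : ℕ} (i : Fin (2 * n)) : Fin (2 * n) :=
  if h : i.val % 2 = 0 then ⟨i.val + 1, by omega⟩ else ⟨i.val - 1, by omega⟩

/-- The matrix `se_ij(z)`. It is written for all `i ≠ j`: if `i ≠ σ(j)` then
`se_ij(z) = se_{σ(j) σ(i)}(-(-1)^(i+j) z)`, and one of `i < j`, `σ(j) < σ(i)` holds, so one gets
the same matrices as from the pairs with `i = σ(j)` or `i < j`. Counting indices from `0` rather
than from `1` does not change the parity of `i + j`. -/
def seMat {n : ℕ} {R : Type*} [CommRing R] (i j : Fin (2 * n)) (z : R) :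
    Matrix (Fin (2 * n)) (Fin (2 * n)) R :=
  if i = sig j then 1 + single i j z
  else 1 + single i j z - single (sig j) (sig i) ((-1) ^ (i.val + j.val) * z)

theorem sig_ne {n : ℕ} (i : Fin (2 * n)) : sig i ≠ i := by
  intro h
  have h1 := congrArg Fin.val h
  unfold sig at h1
  split_ifs at h1 with h2
  · simp at h1
  · simp only at h1
    omega

theorem sig_sig {n : ℕ} (i : Fin (2 * n)) : sig (sig i) = i := by
  apply Fin.ext
  by_cases h : i.val % 2 = 0
  · have h1 : sig i = ⟨i.val + 1, by omega⟩ := dif_pos h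
    have h2 : ¬ (i.val + 1) % 2 = 0 := by omega
    rw [h1, sig, dif_neg h2]
    simp
  · have h1 : sig i = ⟨i.val - 1, by omega⟩ := dif_neg h
    have h2 : (i.val - 1) % 2 = 0 := by omega
    rw [h1, sig, dif_pos h2]
    simp only
    omega

theorem sig_injective {n : ℕ} : Function.Injective (sig : Fin (2 * n) → Fin (2 * n)) :=
  fun i j h => by rw [← sig_sig i, h, sig_sig]

theorem seMat_of_ne {n : ℕ} {R : Type*} [CommRing R] (i j : Fin (2 * n)) (h : i ≠ sig j) (z : R) :
    seMat i j z = (1 + single i j z) *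
      (1 + single (sig j) (sig i) (-((-1) ^ (i.val + j.val) * z))) := by
  have h0 : single i j z * single (sig j) (sig i) (-((-1) ^ (i.val + j.val) * z)) = 0 :=
    single_mul_single_of_ne _ _ _ _ (sig_ne j).symm _
  rw [seMat, if_neg h, add_mul, mul_add, mul_add, h0, ← single_neg]
  simp only [one_mul, mul_one, add_zero]
  abel

theorem det_seMat {n : ℕ} {R : Type*} [CommRing R] (i j : Fin (2 * n)) (hij : i ≠ j) (z : R) :
    (seMat i j z).det = 1 := by
  by_cases h : i = sig j
  · rw [seMat, if_pos h]
    exact det_transvection_of_ne i j hij z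
  · rw [seMat_of_ne i j h, det_mul]
    have h1 := det_transvection_of_ne i j hij z
    have h2 := det_transvection_of_ne (sig j) (sig i) (fun e => hij (sig_injective e).symm)
      (-((-1) ^ (i.val + j.val) * z))
    rw [transvection] at h1 h2
    rw [h1, h2, one_mul]

/-- The elementary symplectic generator `se_ij(z)`, for `i ≠ j`, as an element of `SL_{2n}(R)`. -/
def spGen {n : ℕ} {R : Type*} [CommRing R] (i j : Fin (2 * n)) (hij : i ≠ j) (z : R) :
    SpecialLinearGroup (Fin (2 * n)) R :=
  ⟨seMat i j z, det_seMat i j hij z⟩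

/-- `ESp_{2n}(I)`: the subgroup generated by the `se_ij(x)` with `x ∈ I` and `i ≠ j`. -/
def ESpGen (n : ℕ) {R : Type*} [CommRing R] (I : Ideal R) :
    Subgroup (SpecialLinearGroup (Fin (2 * n)) R) :=
  Subgroup.closure {g | ∃ (i j : Fin (2 * n)) (hij : i ≠ j), ∃ x ∈ I, g = spGen i j hij x}

/-- The elementary symplectic group `ESp_{2n}(R)`. -/
def ESpAbs (n : ℕ) (R : Type*) [CommRing R] : Subgroup (SpecialLinearGroup (Fin (2 * n)) R) :=
  ESpGen n (⊤ : Ideal R)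

/-- The relative elementary symplectic group `ESp_{2n}(R, I)`: the normal closure of
`ESp_{2n}(I)` in `ESp_{2n}(R)`. -/
def ESpRel (n : ℕ) {R : Type*} [CommRing R] (I : Ideal R) :
    Subgroup (SpecialLinearGroup (Fin (2 * n)) R) :=
  normalClosureIn (ESpGen n I) (ESpAbs n R)

theorem ESpGen_le (n : ℕ) {R : Type*} [CommRing R] (I : Ideal R) :
    ESpGen n I ≤ EGen (2 * n) I := by
  refine (Subgroup.closure_le _).2 ?_
  rintro g ⟨i, j, hij, x, hx, rfl⟩
  by_cases h : i = sig j
  · refine Subgroup.subset_closure ⟨i, j, hij, x, hx, Subtype.ext ?_⟩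
    change seMat i j x = 1 + single i j x
    rw [seMat, if_pos h]
  · have hs : sig j ≠ sig i := fun e => hij (sig_injective e).symm
    have e : spGen i j hij x =
        SpecialLinearGroup.transvection hij x * SpecialLinearGroup.transvection hs
          (-((-1) ^ (i.val + j.val) * x)) :=
      Subtype.ext (seMat_of_ne i j h x)
    rw [e]
    exact mul_mem (Subgroup.subset_closure ⟨i, j, hij, x, hx, rfl⟩)
      (Subgroup.subset_closure ⟨_, _, hs, _, I.neg_mem (I.mul_mem_left _ hx), rfl⟩)

theorem normalClosureIn_mono {G : Type*} [Group G] {H H' K K' : Subgroup G}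
    (hH : H ≤ H') (hK : K ≤ K') : normalClosureIn H K ≤ normalClosureIn H' K' := by
  have h : Subgroup.normalClosure ((H.subgroupOf K : Subgroup K) : Set K) ≤
      (Subgroup.normalClosure ((H'.subgroupOf K' : Subgroup K') : Set K')).comap
        (Subgroup.inclusion hK) :=
    Subgroup.normalClosure_le_normal fun x hx =>
      Subgroup.subset_normalClosure (show (x : G) ∈ H' from hH hx)
  rintro g ⟨x, hx, rfl⟩
  exact ⟨Subgroup.inclusion hK x, h hx, rfl⟩

theorem ESpRel_le (n : ℕ) {R : Type*} [CommRing R] (I : Ideal R) :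
    ESpRel n I ≤ ERel (2 * n) I :=
  normalClosureIn_mono (ESpGen_le n I) (ESpGen_le n ⊤)

/-- Equivalence of rows in `Um_m(R, I)` under right multiplication by a subgroup `G` of
`SL_m(R)`: `v ∼ w` if `v = w g` for some `g ∈ G`. -/
def orbitSetoid {m : ℕ} {R : Type*} [CommRing R] (I : Ideal R)
    (G : Subgroup (SpecialLinearGroup (Fin m) R)) : Setoid (Um m I) where
  r v w := ∃ g ∈ G, (v : Fin m → R) = (w : Fin m → R) ᵥ* g.1
  iseqv := by
    refine ⟨fun v => ⟨1, one_mem _, (vecMul_one _).symm⟩, ?_, ?_⟩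
    · rintro v w ⟨g, hg, h⟩
      refine ⟨g⁻¹, inv_mem hg, ?_⟩
      have e : g.1 * (g⁻¹).1 = 1 := congrArg Subtype.val (mul_inv_cancel g)
      rw [h, vecMul_vecMul, e, vecMul_one]
    · rintro u v w ⟨g, hg, h⟩ ⟨k, hk, h'⟩
      refine ⟨k * g, mul_mem hk hg, ?_⟩
      have e : (k * g).1 = k.1 * g.1 := rfl
      rw [h, h', vecMul_vecMul, e]

/-- The orbit space `Um_m(R, I) / G`. -/
def UmOrbits {m : ℕ} {R : Type*} [CommRing R] (I : Ideal R)
    (G : Subgroup (SpecialLinearGroup (Fin m) R)) : Type _ :=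
  Quotient (orbitSetoid I G)

/-- The natural map `Um_{2n}(R, I) / ESp_{2n}(R, I) → Um_{2n}(R, I) / E_{2n}(R, I)`, sending the
class of a row to its class. -/
def naturalMap (n : ℕ) {R : Type*} [CommRing R] (I : Ideal R) :
    UmOrbits I (ESpRel n I) → UmOrbits I (ERel (2 * n) I) :=
  Quotient.map id fun _ _ ⟨g, hg, h⟩ => ⟨g, ESpRel_le n I hg, h⟩

end ElemOrbits

/-!
Call `v ↦ v + x s` a move if `x ∈ I` and some linear form `φ` has `φ v = 1` and `φ s = 0`. The
automorphisms that change each unimodular row by a chain of moves form a normal subgroup, and for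
rows of length at least `3` it contains the elementary transvections with entry in `I`: each of them
is a product of two moves on every unimodular row. Hence it contains `E(R, I)`. On rows of length
`2n` the form `φ` is represented by a row `u` through the standard alternating form, and the move is
the value at `v` of an Eichler transvection with parameters `u` and `x s`, the defect `B(v, s) x u`
being absorbed into the quadratic coefficient. Such a transvection is a product of symplectic
transvections along `u`, `u + s` and `s`. Finally, if `n ≥ 2`, each symplectic transvection with
coefficient in `I` lies in `ESp(R, I)`: split its vector into one hyperbolic plane and the
complement, and note that `e + u` is the image of the basis vector `e` under `ESp(R)` whenever `u`
lies in the complement of the plane of `e`.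
-/

namespace ElemOrbits

open Matrix Module

section NormalClosureIn

variable {G : Type*} [Group G] {H K : Subgroup G}

theorem le_normalClosureIn (h : H ≤ K) : H ≤ normalClosureIn H K := fun x hx =>
  ⟨⟨x, h hx⟩, Subgroup.subset_normalClosure (show x ∈ H from hx), rfl⟩

theorem normalClosureIn_le_of_normal {N : Subgroup G} [N.Normal] (h : H ≤ N) :
    normalClosureIn H K ≤ N := by
  have h' : Subgroup.normalClosure ((H.subgroupOf K : Subgroup K) : Set K) ≤ N.subgroupOf K :=
    Subgroup.normalClosure_le_normal fun _ hg => h hg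
  rintro _ ⟨a, ha, rfl⟩
  exact h' ha

theorem inv_mul_mul_mem_normalClosureIn {g k : G} (hg : g ∈ normalClosureIn H K) (hk : k ∈ K) :
    k⁻¹ * g * k ∈ normalClosureIn H K := by
  obtain ⟨x, hx, rfl⟩ := hg
  refine ⟨(⟨k, hk⟩ : K)⁻¹ * x * ⟨k, hk⟩, ?_, rfl⟩
  simpa using Subgroup.normalClosure_normal.conj_mem x hx (⟨k, hk⟩ : K)⁻¹

end NormalClosureIn

section Eichler

variable {R M : Type*} [CommRing R] [AddCommGroup M] [Module R M]

/-- The Eichler–Siegel–Dickson transvection `v ↦ v + B(v, u) s + B(v, s) u + a B(v, u) u` of a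
bilinear form. It is an isometry if `B` is alternating and `B(u, s) = 0`, but the formula is used
for all `u` and `s`; the case `s = 0` is the symplectic transvection along `u`. -/
def eichler (B : LinearMap.BilinForm R M) (u s : M) (a : R) : End R M :=
  1 + (B.flip u).smulRight (s + a • u) + (B.flip s).smulRight u

variable {B : LinearMap.BilinForm R M}

theorem eichler_apply (u s : M) (a : R) (v : M) :
    eichler B u s a v = v + B v u • (s + a • u) + B v s • u := rfl

theorem eichler_zero (u : M) : eichler B u 0 0 = 1 := by
  ext v
  simp [eichler_apply]

theorem eichler_comm (u s : M) : eichler B u s 0 = eichler B s u 0 := by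
  ext v
  simp only [eichler_apply]
  module

theorem eichler_smul_right (c : R) (u s : M) : eichler B u (c • s) 0 = eichler B (c • u) s 0 := by
  ext v
  simp only [eichler_apply, map_smul, smul_eq_mul]
  module

theorem eichler_mul_eichler (hB : B.IsAlt) {u s t : M} (hs : B u s = 0) (ht : B u t = 0)
    (a b : R) :
    eichler B u s a * eichler B u t b = eichler B u (s + t) (a + b + B t s) := by
  have ht' : B t u = 0 := hB.isRefl _ _ ht
  ext v
  simp only [End.mul_apply, eichler_apply, map_add, map_smul, hs, ht', hB u]
  module

theorem eichler_neg_mul_cancel (hB : B.IsAlt) {u s : M} (hs : B u s = 0) (a : R) :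
    eichler B u (-s) (-a) * eichler B u s a = 1 := by
  rw [eichler_mul_eichler hB (by simp [hs]) hs]
  simp [hB s, eichler_zero]

theorem eichler_add_left (hB : B.IsAlt) {u s : M} (h : B u s = 0) (q : R) :
    eichler B (u + s) 0 q = eichler B u (q • s) q * eichler B s 0 q := by
  have h' : B s u = 0 := hB.isRefl _ _ h
  ext v
  simp only [End.mul_apply, eichler_apply, map_add, map_smul, map_zero, smul_eq_mul, h',
    hB s]
  module

theorem eichler_isometry (hB : B.IsAlt) {u s : M} (h : B u s = 0) (a : R) (v w : M) :
    B (eichler B u s a v) (eichler B u s a w) = B v w := by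
  have h' : B s u = 0 := hB.isRefl _ _ h
  simp only [eichler_apply, map_add, map_smul, LinearMap.add_apply, LinearMap.smul_apply,
    smul_eq_mul, h, h', hB u, hB s, ← hB.neg_eq w u, ← hB.neg_eq w s]
  ring

theorem eichler_mul_of_isometry {f : End R M} (hf : ∀ v w, B (f v) (f w) = B v w)
    (u s : M) (a : R) : eichler B (f u) (f s) a * f = f * eichler B u s a := by
  ext v
  simp only [End.mul_apply, eichler_apply, map_add, map_smul, hf]

end Eichler

section Moves

variable {R M : Type*} [CommRing R] [AddCommGroup M] [Module R M]

/-- An element of a module is unimodular if some linear form takes the value `1` at it. For a row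
this says that its entries generate the unit ideal. -/
def IsUnimodular (R : Type*) {M : Type*} [CommRing R] [AddCommGroup M] [Module R M] (v : M) :
    Prop :=
  ∃ φ : Dual R M, φ v = 1

/-- The element `v'` arises from `v` by a move of level `I` if `v' = v + x s` with `x ∈ I` and `s`
in the kernel of a linear form that takes the value `1` at `v`. -/
def IsMove (I : Ideal R) (v v' : M) : Prop :=
  ∃ (φ : Dual R M) (s : M) (x : R), x ∈ I ∧ φ v = 1 ∧ φ s = 0 ∧ v' = v + x • s

variable {I : Ideal R}

theorem IsUnimodular.map {v : M} (hv : IsUnimodular R v) (g : M ≃ₗ[R] M) :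
    IsUnimodular R (g v) := by
  obtain ⟨φ, hφ⟩ := hv
  exact ⟨φ ∘ₗ g.symm, by simpa using hφ⟩

theorem IsMove.map {v v' : M} (h : IsMove I v v') (g : M ≃ₗ[R] M) : IsMove I (g v) (g v') := by
  obtain ⟨φ, s, x, hx, hv, hs, rfl⟩ := h
  exact ⟨φ ∘ₗ g.symm, g s, x, hx, by simpa using hv, by simpa using hs, by simp⟩

theorem eqvGen_isMove_map {v v' : M} (h : Relation.EqvGen (IsMove I) v v') (g : M ≃ₗ[R] M) :
    Relation.EqvGen (IsMove I) (g v) (g v') := by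
  induction h with
  | rel v v' h => exact .rel _ _ (h.map g)
  | refl v => exact .refl _
  | symm v v' _ ih => exact .symm _ _ ih
  | trans u v w _ _ ih₁ ih₂ => exact .trans _ _ _ ih₁ ih₂

/-- The automorphisms that send each unimodular element to one reachable from it by moves of
level `I`. -/
def moveGroup (M : Type*) [AddCommGroup M] [Module R M] (I : Ideal R) :
    Subgroup (M ≃ₗ[R] M) where
  carrier := {g | ∀ v, IsUnimodular R v → Relation.EqvGen (IsMove I) v (g v)}
  one_mem' v _ := .refl v
  mul_mem' {_ b} ha hb v hv := .trans _ _ _ (hb v hv) (ha _ (hv.map b))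
  inv_mem' {a} ha v hv := by
    simpa [← LinearEquiv.mul_apply] using (ha _ (hv.map a⁻¹)).symm

instance moveGroup_normal : (moveGroup M I).Normal where
  conj_mem a ha g v hv := by
    have h := eqvGen_isMove_map (ha _ (hv.map g⁻¹)) g
    simpa only [← LinearEquiv.mul_apply, mul_inv_cancel, LinearEquiv.coe_one, id_eq, mul_assoc]
      using h

/-- With `φ v = 1`, both steps are along a combination of `a` and `b` that is killed by the current
linear form: `φ b • a - φ a • b` for `φ`, and the same with the roles reversed for a form `ψ` that
agrees with `φ` at `a` and differs from it by `-f v` at `b`. The sum of the two is `f v • a`. -/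
theorem transvection_mem_moveGroup {f g : Dual R M} {a b : M} (hfa : f a = 0) (hfb : f b = 0)
    (hga : g a = 0) (hgb : g b = 1) {x : R} (hx : x ∈ I) :
    LinearEquiv.transvection (f := f) (v := x • a) (by simp [hfa]) ∈ moveGroup M I := by
  rintro v ⟨φ, hφ⟩
  set v' := v + x • (φ b • a - φ a • b) with hv'
  set ψ := φ + (g v' • f - f v' • g) with hψ
  have hfv' : f v' = f v := by simp [hv', hfa, hfb]
  have hψa : ψ a = φ a := by simp [hψ, hfa, hga]
  have hψb : ψ b = φ b - f v := by simp [hψ, hfb, hgb, hfv', sub_eq_add_neg]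
  have hφv' : φ v' = 1 := by simp [hv', hφ, mul_comm]
  have hψv' : ψ v' = 1 := by simp [hψ, hφv', mul_comm]
  have first_move : IsMove I v v' := ⟨φ, _, x, hx, hφ, by simp [mul_comm], hv'⟩
  have second_move : IsMove I v' (LinearEquiv.transvection (f := f) (v := x • a)
      (by simp [hfa]) v) := by
    refine ⟨ψ, ψ a • b - ψ b • a, x, hx, hψv', by simp [mul_comm], ?_⟩
    rw [LinearEquiv.transvection.apply, hψa, hψb, hv']
    module
  exact .trans _ _ _ (.rel _ _ first_move) (.rel _ _ second_move)

theorem IsMove.exists_eichler {B : LinearMap.BilinForm R M} (hB : B.IsAlt)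
    (hsurj : ∀ φ : Dual R M, ∃ u, ∀ v, B v u = φ v) {v v' : M} (h : IsMove I v v') :
    ∃ u s, ∃ x ∈ I, ∃ y ∈ I, B u s = 0 ∧ v' = eichler B u (x • s) y v := by
  obtain ⟨φ, s, x, hx, hv, hs, rfl⟩ := h
  obtain ⟨u, hu⟩ := hsurj φ
  refine ⟨u, s, x, hx, -(x * B v s), I.neg_mem (I.mul_mem_right _ hx),
    hB.isRefl _ _ (by rw [hu, hs]), ?_⟩
  rw [eichler_apply, hu, hv, map_smul, smul_eq_mul]
  module

end Moves

section RowAction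

/-- The action `v ↦ v g⁻¹` of `SL_m(R)` on rows. The inverse turns right multiplication into a left
action. -/
def rowAction (m : ℕ) (R : Type*) [CommRing R] :
    SpecialLinearGroup (Fin m) R →* ((Fin m → R) ≃ₗ[R] (Fin m → R)) where
  toFun g := Matrix.toLinearEquivRight'OfInv (M := g.1) (M' := (g⁻¹).1)
    (congrArg Subtype.val (mul_inv_cancel g)) (congrArg Subtype.val (inv_mul_cancel g))
  map_one' := by
    ext1 v
    change v ᵥ* (1⁻¹ : SpecialLinearGroup (Fin m) R).1 = v
    rw [inv_one]
    exact vecMul_one v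
  map_mul' g h := by
    ext1 v
    change v ᵥ* ((g * h)⁻¹).1 = (v ᵥ* (h⁻¹).1) ᵥ* (g⁻¹).1
    rw [vecMul_vecMul, _root_.mul_inv_rev]
    rfl

variable {m : ℕ} {R : Type*} [CommRing R]

theorem rowAction_apply (g : SpecialLinearGroup (Fin m) R) (v : Fin m → R) :
    rowAction m R g v = v ᵥ* (g⁻¹).1 := rfl

theorem rowAction_inv_apply (g : SpecialLinearGroup (Fin m) R) (v : Fin m → R) :
    rowAction m R g⁻¹ v = v ᵥ* g.1 := by
  rw [rowAction_apply, inv_inv]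

theorem orbitRel_map_rowAction {G : Subgroup (SpecialLinearGroup (Fin m) R)} {v w : Fin m → R} :
    MulAction.orbitRel (G.map (rowAction m R)) (Fin m → R) v w ↔ ∃ g ∈ G, v = w ᵥ* g.1 := by
  constructor
  · rintro ⟨⟨_, g, hg, rfl⟩, rfl⟩
    exact ⟨g⁻¹, inv_mem hg, rfl⟩
  · rintro ⟨g, hg, rfl⟩
    exact ⟨⟨_, g⁻¹, inv_mem hg, rfl⟩, rowAction_inv_apply g w⟩

theorem isUnimodular_of_sum_eq_one {v w : Fin m → R} (h : ∑ i, v i * w i = 1) :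
    IsUnimodular R v :=
  ⟨∑ i, w i • LinearMap.proj i, by simpa [mul_comm] using h⟩

theorem vecMul_matrix_single (v : Fin m → R) (i j : Fin m) (z : R) :
    v ᵥ* single i j z = (z * v i) • Pi.single j 1 := by
  rw [← mulVec_transpose, transpose_single, single_mulVec_eq]

theorem rowAction_transvection_mem_moveGroup (hm : 3 ≤ m) {I : Ideal R} {i j : Fin m}
    (hij : i ≠ j) {x : R} (hx : x ∈ I) :
    rowAction m R (SpecialLinearGroup.transvection hij x) ∈ moveGroup (Fin m → R) I := by
  obtain ⟨l, hli, hlj⟩ := Fin.exists_ne_and_ne_of_two_lt i j hm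
  have h := transvection_mem_moveGroup (f := LinearMap.proj i) (g := LinearMap.proj l)
    (a := (Pi.single j 1 : Fin m → R)) (b := Pi.single l 1) (by simp [hij]) (by simp [hli.symm])
    (by simp [hlj]) (by simp) hx
  rw [← inv_mem_iff, ← map_inv]
  convert h using 1
  ext1 v
  rw [rowAction_inv_apply, SpecialLinearGroup.transvection_coe, vecMul_add, vecMul_one,
    vecMul_matrix_single, LinearEquiv.transvection.apply, LinearMap.proj_apply]
  module

theorem map_ERel_le_moveGroup (hm : 3 ≤ m) (I : Ideal R) :
    (ERel m I).map (rowAction m R) ≤ moveGroup (Fin m → R) I := by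
  refine Subgroup.map_le_iff_le_comap.2 (normalClosureIn_le_of_normal ?_)
  refine (Subgroup.closure_le _).2 ?_
  rintro _ ⟨i, j, hij, x, hx, rfl⟩
  exact rowAction_transvection_mem_moveGroup hm hij hx

/-- The endomorphisms `v ↦ v g` of the module of rows with `g` in a given subgroup of
`SL_m(R)`. -/
def rowMaps (G : Subgroup (SpecialLinearGroup (Fin m) R)) : Submonoid (End R (Fin m → R)) where
  carrier := {f | ∃ g ∈ G, ∀ v, f v = v ᵥ* g.1}
  one_mem' := ⟨1, one_mem G, fun v => (vecMul_one v).symm⟩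
  mul_mem' := by
    rintro f f' ⟨g, hg, hf⟩ ⟨g', hg', hf'⟩
    refine ⟨g' * g, mul_mem hg' hg, fun v => ?_⟩
    rw [End.mul_apply, hf, hf', vecMul_vecMul]
    rfl

theorem rowMaps_mono {G G' : Subgroup (SpecialLinearGroup (Fin m) R)} (h : G ≤ G') :
    rowMaps G ≤ rowMaps G' := fun _ ⟨g, hg, hf⟩ => ⟨g, h hg, hf⟩

theorem mem_rowMaps_normalClosureIn_of_mul_eq {H K : Subgroup (SpecialLinearGroup (Fin m) R)}
    {f f' k : End R (Fin m → R)} (hf : f ∈ rowMaps (normalClosureIn H K)) (hk : k ∈ rowMaps K)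
    (h : f' * k = k * f) : f' ∈ rowMaps (normalClosureIn H K) := by
  obtain ⟨g, hg, hfg⟩ := hf
  obtain ⟨c, hc, hkc⟩ := hk
  refine ⟨c⁻¹ * g * c, inv_mul_mul_mem_normalClosureIn hg hc, fun v => ?_⟩
  have inv_mul : (c⁻¹).1 * c.1 = 1 := congrArg Subtype.val (inv_mul_cancel c)
  have hv : v = k (v ᵥ* (c⁻¹).1) := by rw [hkc, vecMul_vecMul, inv_mul, vecMul_one]
  calc f' v = (f' * k) (v ᵥ* (c⁻¹).1) := congrArg f' hv
    _ = v ᵥ* ((c⁻¹).1 * g.1 * c.1) := by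
      rw [h, End.mul_apply, hkc, hfg, vecMul_vecMul, vecMul_vecMul, Matrix.mul_assoc]

end RowAction

section SymplecticForm

/-- The standard alternating form `∑ i, (-1) ^ i * v i * u (σ i)` on rows of length `2n`, that is
`(v₀ u₁ - v₁ u₀) + (v₂ u₃ - v₃ u₂) + ⋯`. -/
def symplecticForm (n : ℕ) (R : Type*) [CommRing R] : LinearMap.BilinForm R (Fin (2 * n) → R) :=
  ∑ i : Fin (2 * n), (-1 : R) ^ i.val •
    LinearMap.BilinForm.linMulLin (LinearMap.proj i) (LinearMap.proj (sig i))

variable {n : ℕ} {R : Type*} [CommRing R]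

theorem symplecticForm_apply (v u : Fin (2 * n) → R) :
    symplecticForm n R v u = ∑ i, (-1) ^ i.val * (v i * u (sig i)) := by
  simp [symplecticForm]

theorem neg_one_pow_sig (i : Fin (2 * n)) : (-1 : R) ^ (sig i).val = -(-1) ^ i.val := by
  unfold sig
  split_ifs with h
  · exact pow_succ (-1) i.val |>.trans (mul_neg_one _)
  · obtain ⟨k, hk⟩ : ∃ k, i.val = k + 1 := ⟨i.val - 1, by omega⟩
    simp [hk, pow_succ]

theorem symplecticForm_isAlt : (symplecticForm n R).IsAlt := fun u => by
  rw [symplecticForm_apply]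
  refine Finset.sum_involution (fun i _ => sig i) (fun i _ => ?_) (fun i _ _ => sig_ne i)
    (fun i _ => Finset.mem_univ _) (fun i _ => sig_sig i)
  rw [sig_sig, neg_one_pow_sig]
  ring

theorem symplecticForm_single_left (j : Fin (2 * n)) (u : Fin (2 * n) → R) :
    symplecticForm n R (Pi.single j 1) u = (-1) ^ j.val * u (sig j) := by
  simp [symplecticForm_apply, Pi.single_apply]

theorem symplecticForm_single_right (v : Fin (2 * n) → R) (j : Fin (2 * n)) :
    symplecticForm n R v (Pi.single j 1) = (-1) ^ (sig j).val * v (sig j) := by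
  rw [← symplecticForm_isAlt.neg_eq, symplecticForm_single_left, neg_one_pow_sig]
  ring

theorem exists_symplecticForm_eq (φ : Dual R (Fin (2 * n) → R)) :
    ∃ u, ∀ v, symplecticForm n R v u = φ v := by
  refine ⟨fun i => (-1) ^ (sig i).val * φ (Pi.single (sig i) 1), fun v => ?_⟩
  conv_rhs => rw [pi_eq_sum_univ' v, map_sum]
  rw [symplecticForm_apply]
  refine Finset.sum_congr rfl fun i _ => ?_
  have hsq : (-1 : R) ^ i.val * (-1) ^ i.val = 1 := by rw [← mul_pow]; simp
  rw [sig_sig, map_smul, smul_eq_mul]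
  linear_combination v i * φ (Pi.single i 1) * hsq

end SymplecticForm

section Membership

variable {n : ℕ} {R : Type*} [CommRing R] {J I : Ideal R}

theorem ESpGen_mono (h : I ≤ J) : ESpGen n I ≤ ESpGen n J := by
  refine Subgroup.closure_mono ?_
  rintro g ⟨i, j, hij, x, hx, rfl⟩
  exact ⟨i, j, hij, x, h hx, rfl⟩

theorem ESpGen_le_ESpRel (I : Ideal R) : ESpGen n I ≤ ESpRel n I :=
  le_normalClosureIn (ESpGen_mono le_top)

theorem mem_rowMaps_ESpGen_of_eq_seMat {f : End R (Fin (2 * n) → R)} {i j : Fin (2 * n)}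
    (hij : i ≠ j) {z : R} (hz : z ∈ J) (h : ∀ v, f v = v ᵥ* seMat i j z) :
    f ∈ rowMaps (ESpGen n J) :=
  ⟨spGen i j hij z, Subgroup.subset_closure ⟨i, j, hij, z, hz, rfl⟩, h⟩

theorem eichler_single_zero_mem (j : Fin (2 * n)) {a : R} (ha : a ∈ J) :
    eichler (symplecticForm n R) (Pi.single j 1) 0 a ∈ rowMaps (ESpGen n J) := by
  refine mem_rowMaps_ESpGen_of_eq_seMat (sig_ne j)
    (J.mul_mem_left ((-1) ^ (sig j).val) ha) fun v => ?_
  rw [seMat, if_pos rfl, vecMul_add, vecMul_one, vecMul_matrix_single, eichler_apply,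
    symplecticForm_single_right, map_zero]
  module

theorem eichler_single_single_mem {j k : Fin (2 * n)} (hkj : k ≠ j) (hk : k ≠ sig j) {y : R}
    (hy : y ∈ J) :
    eichler (symplecticForm n R) (Pi.single j 1) (y • Pi.single k 1) 0 ∈
      rowMaps (ESpGen n J) := by
  have hij : sig k ≠ j := fun h => hk (by rw [← h, sig_sig])
  refine mem_rowMaps_ESpGen_of_eq_seMat hij (J.mul_mem_left ((-1) ^ (sig k).val) hy) fun v => ?_
  have sign_eq : (-1 : R) ^ ((sig k).val + j.val) * ((-1) ^ (sig k).val * y) =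
      -((-1) ^ (sig j).val * y) := by
    rw [pow_add, neg_one_pow_sig, neg_one_pow_sig]
    have hsq : (-1 : R) ^ k.val * (-1) ^ k.val = 1 := by rw [← mul_pow]; simp
    linear_combination (-1 : R) ^ j.val * y * hsq
  rw [seMat, if_neg fun h => hkj (sig_injective h), sign_eq, vecMul_sub, vecMul_add, vecMul_one,
    vecMul_matrix_single, vecMul_matrix_single, eichler_apply, map_smul,
    symplecticForm_single_right, symplecticForm_single_right, sig_sig, smul_eq_mul]
  module

theorem eichler_single_mem (j : Fin (2 * n)) {s : Fin (2 * n) → R} (hs : ∀ i, s i ∈ J)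
    (hj : s j = 0) (hj' : s (sig j) = 0) {a : R} (ha : a ∈ J) :
    eichler (symplecticForm n R) (Pi.single j 1) s a ∈ rowMaps (ESpGen n J) := by
  suffices h : ∀ (S : Finset (Fin (2 * n))) (a : R), a ∈ J →
      eichler (symplecticForm n R) (Pi.single j 1) (∑ k ∈ S, s k • Pi.single k 1) a ∈
        rowMaps (ESpGen n J) by
    rw [pi_eq_sum_univ' s]
    exact h Finset.univ a ha
  intro S
  induction S using Finset.induction_on with
  | empty => exact fun a ha => eichler_single_zero_mem j ha
  | insert k S hkS ih =>
    intro a ha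
    rw [Finset.sum_insert hkS]
    by_cases hkj : k = j
    · simpa [hkj, hj] using ih a ha
    by_cases hkj' : k = sig j
    · simpa [hkj', hj'] using ih a ha
    set t := ∑ l ∈ S, s l • (Pi.single l 1 : Fin (2 * n) → R) with ht
    have ort_k : symplecticForm n R (Pi.single j 1) (s k • Pi.single k 1) = 0 := by
      simp [symplecticForm_single_left, Ne.symm hkj']
    have ort_t : symplecticForm n R (Pi.single j 1) t = 0 := by
      simp [symplecticForm_single_left, ht, Pi.single_apply, hj']
    have hmul := eichler_mul_eichler symplecticForm_isAlt ort_k ort_t 0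
      (a - symplecticForm n R t (s k • Pi.single k 1))
    rw [zero_add, sub_add_cancel] at hmul
    rw [← hmul]
    refine mul_mem (eichler_single_single_mem hkj hkj' (hs k)) (ih _ (sub_mem ha ?_))
    rw [map_smul]
    exact J.mul_mem_right _ (hs k)

theorem eichler_single_smul_mem_ESpRel (i : Fin (2 * n)) {u : Fin (2 * n) → R} (hi : u i = 0)
    (hi' : u (sig i) = 0) {q a : R} (hq : q ∈ I) (ha : a ∈ I) :
    eichler (symplecticForm n R) (Pi.single i 1) (q • u) a ∈ rowMaps (ESpRel n I) :=
  rowMaps_mono (ESpGen_le_ESpRel I) (eichler_single_mem i (fun _ => I.mul_mem_right _ hq)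
    (by simp [hi]) (by simp [hi']) ha)

theorem eichler_single_add_zero_mem (i : Fin (2 * n)) {u : Fin (2 * n) → R} (hi : u i = 0)
    (hi' : u (sig i) = 0) {q : R} (hq : q ∈ I) :
    eichler (symplecticForm n R) (Pi.single i 1 + u) 0 q ∈ rowMaps (ESpRel n I) := by
  set k := eichler (symplecticForm n R) (Pi.single (sig i) 1) ((-1 : R) ^ i.val • u) 0 with hk
  have k_mem : k ∈ rowMaps (ESpAbs n R) :=
    eichler_single_mem (sig i) (fun _ => Submodule.mem_top) (by simp [hi'])
      (by simp [sig_sig, hi]) (zero_mem _)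
  have k_isometry := eichler_isometry (symplecticForm_isAlt (R := R))
    (u := Pi.single (sig i) 1) (s := (-1 : R) ^ i.val • u)
    (by simp [symplecticForm_single_left, sig_sig, hi]) 0
  have k_single : k (Pi.single i 1) = Pi.single i 1 + u := by
    simp [hk, eichler_apply, symplecticForm_single_left, hi', smul_smul, ← mul_pow]
  have conj := eichler_mul_of_isometry k_isometry (Pi.single i 1) 0 q
  rw [← hk, k_single, map_zero] at conj
  exact mem_rowMaps_normalClosureIn_of_mul_eq
    (rowMaps_mono (ESpGen_le_ESpRel I) (eichler_single_zero_mem i hq)) k_mem conj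

theorem eichler_zero_mem_of_apply_eq_zero (i : Fin (2 * n)) {u : Fin (2 * n) → R} (hi : u i = 0)
    (hi' : u (sig i) = 0) {q : R} (hq : q ∈ I) :
    eichler (symplecticForm n R) u 0 q ∈ rowMaps (ESpRel n I) := by
  have ort : symplecticForm n R (Pi.single i 1) (q • u) = 0 := by
    simp [symplecticForm_single_left, hi']
  have factor : eichler (symplecticForm n R) u 0 q =
      eichler (symplecticForm n R) (Pi.single i 1) (-q • u) (-q) *
        eichler (symplecticForm n R) (Pi.single i 1 + u) 0 q := by
    rw [eichler_add_left symplecticForm_isAlt (by simp [symplecticForm_single_left, hi']),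
      ← mul_assoc, neg_smul, eichler_neg_mul_cancel symplecticForm_isAlt ort, one_mul]
  rw [factor]
  exact mul_mem (eichler_single_smul_mem_ESpRel i hi hi' (neg_mem hq) (neg_mem hq))
    (eichler_single_add_zero_mem i hi hi' hq)

theorem eichler_smul_single_mem (i : Fin (2 * n)) {u : Fin (2 * n) → R} (hi : u i = 0)
    (hi' : u (sig i) = 0) {c : R} (hc : c ∈ I) :
    eichler (symplecticForm n R) u (c • Pi.single i 1) 0 ∈ rowMaps (ESpRel n I) := by
  rw [eichler_smul_right, eichler_comm]
  exact eichler_single_smul_mem_ESpRel i hi hi' hc (zero_mem I)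

theorem eichler_plane_mem (i : Fin (2 * n)) {u : Fin (2 * n) → R} (hi : u i = 0)
    (hi' : u (sig i) = 0) {c d a : R} (hc : c ∈ I) (hd : d ∈ I) (ha : a ∈ I) :
    eichler (symplecticForm n R) u (c • Pi.single i 1 + d • Pi.single (sig i) 1) a ∈
      rowMaps (ESpRel n I) := by
  set e : Fin (2 * n) → R := Pi.single i 1
  set f : Fin (2 * n) → R := Pi.single (sig i) 1
  have ort_e : symplecticForm n R u (c • e) = 0 := by
    simp [e, symplecticForm_single_right, hi']
  have ort_f : symplecticForm n R u (d • f) = 0 := by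
    simp [f, symplecticForm_single_right, sig_sig, hi]
  have factor : eichler (symplecticForm n R) u (c • e + d • f) a =
      eichler (symplecticForm n R) u (c • e) 0 * eichler (symplecticForm n R) u (d • f) 0 *
        eichler (symplecticForm n R) u 0 (a - symplecticForm n R (d • f) (c • e)) := by
    rw [eichler_mul_eichler symplecticForm_isAlt ort_e ort_f,
      eichler_mul_eichler symplecticForm_isAlt (by rw [map_add, ort_e, ort_f, add_zero])
        (map_zero _), add_zero, zero_add, zero_add, LinearMap.map_zero₂, add_zero,
      add_sub_cancel]
  have coeff_mem : a - symplecticForm n R (d • f) (c • e) ∈ I :=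
    sub_mem ha (by rw [map_smul]; exact I.mul_mem_right _ hc)
  rw [factor]
  exact mul_mem (mul_mem (eichler_smul_single_mem i hi hi' hc)
    (eichler_smul_single_mem (sig i) hi' (by rw [sig_sig, hi]) hd))
    (eichler_zero_mem_of_apply_eq_zero i hi hi' coeff_mem)

theorem eichler_zero_mem (hn : 2 ≤ n) (u : Fin (2 * n) → R) {q : R} (hq : q ∈ I) :
    eichler (symplecticForm n R) u 0 q ∈ rowMaps (ESpRel n I) := by
  obtain ⟨i, k, hki, hki'⟩ : ∃ i k : Fin (2 * n), k ≠ i ∧ k ≠ sig i :=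
    ⟨⟨0, by omega⟩, ⟨2, by omega⟩, by simp, by simp [sig]⟩
  have hk'i : sig k ≠ i := fun h => hki' (by rw [← h, sig_sig])
  have hk'i' : sig k ≠ sig i := fun h => hki (sig_injective h)
  set a : Fin (2 * n) → R := u i • Pi.single i 1 + u (sig i) • Pi.single (sig i) 1 with ha
  set b : Fin (2 * n) → R := u - a with hb
  have hbi : b i = 0 := by simp [hb, ha, (sig_ne i).symm]
  have hbi' : b (sig i) = 0 := by simp [hb, ha, sig_ne i]
  have ort : symplecticForm n R b a = 0 := by
    simp [ha, symplecticForm_single_right, sig_sig, hbi, hbi']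
  have a_mem : eichler (symplecticForm n R) a 0 q ∈ rowMaps (ESpRel n I) :=
    eichler_zero_mem_of_apply_eq_zero k (by simp [ha, hki, hki']) (by simp [ha, hk'i, hk'i']) hq
  have mixed_mem : eichler (symplecticForm n R) b (q • a) q ∈ rowMaps (ESpRel n I) := by
    rw [ha, smul_add, smul_smul, smul_smul]
    exact eichler_plane_mem i hbi hbi' (I.mul_mem_right _ hq) (I.mul_mem_right _ hq) hq
  rw [← sub_add_cancel u a, eichler_add_left symplecticForm_isAlt ort]
  exact mul_mem mixed_mem a_mem

theorem eichler_smul_mem (hn : 2 ≤ n) {u s : Fin (2 * n) → R} (h : symplecticForm n R u s = 0)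
    {x y : R} (hx : x ∈ I) (hy : y ∈ I) :
    eichler (symplecticForm n R) u (x • s) y ∈ rowMaps (ESpRel n I) := by
  have factor : eichler (symplecticForm n R) u (x • s) y =
      eichler (symplecticForm n R) u 0 (y - x) *
        (eichler (symplecticForm n R) (u + s) 0 x * eichler (symplecticForm n R) s 0 (-x)) := by
    have cancel :
        eichler (symplecticForm n R) s 0 x * eichler (symplecticForm n R) s 0 (-x) = 1 := by
      simpa using eichler_neg_mul_cancel symplecticForm_isAlt (map_zero (symplecticForm n R s)) (-x)
    rw [eichler_add_left symplecticForm_isAlt h, mul_assoc, cancel, mul_one,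
      eichler_mul_eichler symplecticForm_isAlt (map_zero _) (by simp [h])]
    simp
  rw [factor]
  exact mul_mem (eichler_zero_mem hn u (sub_mem hy hx))
    (mul_mem (eichler_zero_mem hn (u + s) hx) (eichler_zero_mem hn s (neg_mem hx)))

end Membership

section Orbits

variable {n : ℕ} {R : Type*} [CommRing R] {I : Ideal R}

theorem IsMove.orbitRel_ESpRel (hn : 2 ≤ n) {v v' : Fin (2 * n) → R} (h : IsMove I v v') :
    MulAction.orbitRel ((ESpRel n I).map (rowAction (2 * n) R)) _ v v' := by
  obtain ⟨u, s, x, hx, y, hy, hus, rfl⟩ :=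
    h.exists_eichler symplecticForm_isAlt exists_symplecticForm_eq
  obtain ⟨g, hg, hfg⟩ := eichler_smul_mem hn hus hx hy
  exact Setoid.symm' _ (orbitRel_map_rowAction.2 ⟨g, hg, hfg v⟩)

theorem exists_mem_ESpRel_vecMul_eq (hn : 2 ≤ n) {w : Fin (2 * n) → R} (hw : IsUnimodular R w)
    {g : SpecialLinearGroup (Fin (2 * n)) R} (hg : g ∈ ERel (2 * n) I) :
    ∃ k ∈ ESpRel n I, w ᵥ* g.1 = w ᵥ* k.1 := by
  have hmove : Relation.EqvGen (IsMove I) w (w ᵥ* g.1) := by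
    rw [← rowAction_inv_apply]
    exact map_ERel_le_moveGroup (by omega) I ⟨g⁻¹, inv_mem hg, rfl⟩ w hw
  exact orbitRel_map_rowAction.1
    (Setoid.eqvGen_le (fun _ _ h => IsMove.orbitRel_ESpRel hn h) hmove.symm)

end Orbits

end ElemOrbits

theorem mainTheorem6_general {R : Type*} [CommRing R] (I : Ideal R) (n : ℕ) (hn : 2 ≤ n) :
    Function.Bijective (ElemOrbits.naturalMap n I) := by
  constructor
  · rintro ⟨v⟩ ⟨w⟩ h
    obtain ⟨g, hg, hvw⟩ : ∃ g ∈ ElemOrbits.ERel (2 * n) I,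
        (v : Fin (2 * n) → R) = Matrix.vecMul (w : Fin (2 * n) → R) g.1 := Quotient.exact h
    obtain ⟨c, hc⟩ := w.2.1
    obtain ⟨k, hk, hgk⟩ :=
      ElemOrbits.exists_mem_ESpRel_vecMul_eq hn (ElemOrbits.isUnimodular_of_sum_eq_one hc) hg
    exact Quotient.sound ⟨k, hk, hvw.trans hgk⟩
  · rintro ⟨w⟩
    exact ⟨Quotient.mk _ w, rfl⟩

/-- If `2` is invertible in the commutative ring `R`, then for every ideal `I` and all `n ≥ 2` the
natural map `Um_{2n}(R, I) / ESp_{2n}(R, I) → Um_{2n}(R, I) / E_{2n}(R, I)` is bijective. -/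
theorem mainTheorem6 {R : Type*} [CommRing R] (h2 : IsUnit (2 : R)) (I : Ideal R) (n : ℕ)
    (hn : 2 ≤ n) : Function.Bijective (ElemOrbits.naturalMap n I) :=
  mainTheorem6_general I n hn
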